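/- For a set $A$ of ordinals let $\mathrm{acc}(A)$ be the set of nonzero ordinals $\beta<\sup A$ such that $A\cap\beta$ is unbounded in $\beta$; in particular, for an infinite cardinal $\kappa$, $\mathrm{acc}(\kappa)$ is the set of nonzero limit ordinals below $\kappa$. For an uncountable regular cardinal $\kappa$, the principle $\square(\kappa)$ asserts that there is a sequence $\langle C_\alpha\mid\alpha<\kappa\rangle$ such that 1. $C_\alpha$ is a closed unbounded (club) subset of $\alpha$ for all $\alpha\in\mathrm{acc}(\kappa)$; 2. $C_\beta\cap\alpha=C_\alpha$ for all $\alpha,\beta\in\mathrm{acc}(\kappa)$ with $\alpha\in\mathrm{acc}(C_\beta)$; 3. there is no club subset $D$ of $\kappa$ with $D\cap\alpha=C_\alpha$ for all $\alpha\in\mathrm{acc}(D)$. A tree is a partial order $\mathbb{T}$ in which the set of predecessors $\{s\in\mathbb{T}\mid s<_{\mathbb{T}}t\}$ of every $t\in\mathbb{T}$ is well-ordered by $<_{\mathbb{T}}$; the height of $t$ is the order type of this set, the $\alpha$-th level $\mathbb{T}(\alpha)$ is the set of all nodes of height $\alpha$, and the height of $\mathbb{T}$ is the least ordinal $\alpha$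 with $\mathbb{T}(\alpha)=\emptyset$. A cofinal branch through $\mathbb{T}$ is a linearly ordered subset of $\mathbb{T}$ such that the heights of its elements are cofinal in the height of $\mathbb{T}$. A $\kappa$-Aronszajn tree is a tree of height $\kappa$ with $|\mathbb{T}(\alpha)|<\kappa$ for all $\alpha<\kappa$ and without cofinal branches. For infinite cardinals $\lambda<\kappa$ and a tree $\mathbb{T}$ of height $\kappa$, a $\lambda$-ascent path through $\mathbb{T}$ is a sequence $\langle b_\alpha:\lambda\to\mathbb{T}(\alpha)\mid\alpha<\kappa\rangle$ of functions such that for all $\alpha<\beta<\kappa$ there is an $i<\lambda$ with $b_\alpha(j)<_{\mathbb{T}}b_\beta(j)$ for all $i\leq j<\lambda$. **Theorem.** Let $\lambda<\kappa$ be infinite regular cardinals. If $\square(\kappa)$ holds, then there is a $\kappa$-Aronszajn tree with a $\lambda$-ascent path. -/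

import Mathlib

open Set Cardinal

universe u

/-! ### Square sequences -/

/-- The accumulation points of a set `A` of ordinals: the ordinals `0 < β < sup A` such that
`A ∩ β` is unbounded in `β`. In particular `acc κ`, that is `acc (Iio κ.ord)`, is the set of
(nonzero) limit ordinals below `κ`. -/
def acc (A : Set Ordinal.{u}) : Set Ordinal.{u} :=
  {β | β ≠ 0 ∧ (∃ γ ∈ A, β < γ) ∧ ∀ γ < β, ∃ δ ∈ A, γ < δ ∧ δ < β}

/-- `C` is a club (closed unbounded) subset of the ordinal `α`. -/
def IsClubSubset (C : Set Ordinal.{u}) (α : Ordinal.{u}) : Prop :=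
  C ⊆ Iio α ∧ IsClub {x : Iio α | (x : Ordinal.{u}) ∈ C}

/-- `⟨C α : α < κ⟩` is a `□(κ)`-sequence. Only the values `C α` for limit ordinals `α < κ`
matter. -/
structure IsSquareSeq (κ : Cardinal.{u}) (C : Ordinal.{u} → Set Ordinal.{u}) : Prop where
  club : ∀ α ∈ acc (Iio κ.ord), IsClubSubset (C α) α
  coherent : ∀ α ∈ acc (Iio κ.ord), ∀ β ∈ acc (Iio κ.ord), α ∈ acc (C β) → C β ∩ Iio α = C α
  no_thread : ¬ ∃ D : Set Ordinal.{u}, IsClubSubset D κ.ord ∧ ∀ α ∈ acc D, D ∩ Iio α = C α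

/-- The principle `□(κ)`. -/
def Square (κ : Cardinal.{u}) : Prop :=
  ∃ C : Ordinal.{u} → Set Ordinal.{u}, IsSquareSeq κ C

/-! ### Trees -/

/-- A set-theoretic tree: a partial order in which the predecessors of every node are
well-ordered. -/
class SetTree (T : Type u) extends PartialOrder T where
  wellOrder_pred : ∀ t : T, IsWellOrder (Iio t) (· < ·)

namespace SetTree

attribute [instance] SetTree.wellOrder_pred

variable {T : Type u} [SetTree T]

/-- The height of a node: the order type of its set of predecessors. -/
noncomputable def nodeHeight (t : T) : Ordinal.{u} :=
  Ordinal.type (α := Iio t) (· < ·)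

variable (T) in
/-- The `α`-th level of the tree. -/
def level (α : Ordinal.{u}) : Set T :=
  {t | nodeHeight t = α}

variable (T) in
/-- Some level is empty, so the infimum in the next definition is a minimum. -/
theorem exists_level_eq_empty : ∃ α, level T α = ∅ := by
  obtain ⟨b, hb⟩ := Ordinal.bddAbove_of_small (s := range (nodeHeight (T := T)))
  refine ⟨Order.succ b, eq_empty_of_forall_notMem fun t ht => ?_⟩
  have h : nodeHeight t ≤ b := hb ⟨t, rfl⟩
  exact absurd (Order.lt_succ b) (not_lt.2 ((show nodeHeight t = Order.succ b from ht) ▸ h))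

variable (T) in
/-- The height of the tree: the least ordinal `α` such that the `α`-th level is empty. -/
noncomputable def height : Ordinal.{u} :=
  sInf {α | level T α = ∅}

/-- A branch is a set of nodes linearly ordered by the tree order. -/
def IsBranch (B : Set T) : Prop :=
  IsChain (· ≤ ·) B

/-- A branch is cofinal if the heights of its nodes are cofinal in the height of the tree. -/
def IsCofinalBranch (B : Set T) : Prop :=
  IsBranch B ∧ ∀ α < height T, ∃ t ∈ B, α ≤ nodeHeight t

variable (T) in
/-- `T` is a `κ`-tree: it has height `κ`, and its levels have fewer than `κ` nodes. -/
def IsKappaTree (κ : Cardinal.{u}) : Prop :=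
  height T = κ.ord ∧ ∀ α < κ.ord, #(level T α) < κ

variable (T) in
/-- `T` is a `κ`-Aronszajn tree: a `κ`-tree without cofinal branches. -/
def IsAronszajn (κ : Cardinal.{u}) : Prop :=
  IsKappaTree T κ ∧ ¬ ∃ B : Set T, IsCofinalBranch B

/-- `⟨b α : lam → T(α) | α < κ⟩` is a `lam`-ascent path through the tree `T` of height `κ`. -/
def IsAscentPath {κ lam : Cardinal.{u}} (b : Iio κ.ord → Iio lam.ord → T) : Prop :=
  (∀ (α : Iio κ.ord) (i : Iio lam.ord), b α i ∈ level T (α : Ordinal.{u})) ∧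
    ∀ α β : Iio κ.ord, α < β → ∃ i : Iio lam.ord, ∀ j, i ≤ j → b α j < b β j

end SetTree

open Ordinal

/-! The tree is read off a function `rho` from pairs below `κ` into `lam`. Its nodes are
restrictions of the functions `max j (rho β ·)`, ordered by extension with `j` fixed, and three
properties of `rho` suffice. Subadditivity (`rho_subadditive`) makes `max j (rho α ·)` and `max j
(rho β ·)` agree below `α` once `j ≥ rho β α`; this is the ascent path. The number of traces at a
level is small (`mk_rhoTraces_le`), so levels are small. Finally, `rho` is unbounded on every
unbounded set (`rho_unbounded`), which excludes cofinal branches: a branch yields one function into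
`lam` dominating some `rho β ·` on every initial segment; as `lam < κ`, it is constant on an
unbounded set, and subadditivity would bound `rho` there.

The absence of a thread yields a coherent sequence `D` with a coloring `h` into `lam` that is
constant along the accumulation points of each `D β` and takes arbitrarily large values on every
club (`Square.exists_coloredCSeq`). `rho` walks down along `D`, and each step absorbs the color of
`β` and the values of `rho` on earlier pairs of the ladder. Absorbing the pairs gives subadditivity,
while coherence keeps their supremum below `lam`. Unboundedness comes from `h β ≤ rho β ξ` together
with the closure property `rho_le_of_cofinal`. -/

theorem isClubSubset_iff {C : Set Ordinal.{u}} {α : Ordinal.{u}}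
    (hα : ∀ γ < α, Order.succ γ < α) :
    IsClubSubset C α ↔ C ⊆ Iio α ∧ (∀ γ < α, ∃ δ ∈ C, γ < δ) ∧
      ∀ β < α, β ≠ 0 → (∀ γ < β, ∃ δ ∈ C, γ < δ ∧ δ < β) → β ∈ C := by
  constructor
  · rintro ⟨hs, hcl, hcof⟩
    refine ⟨hs, fun γ hγ => ?_, fun β hβ h0 h => ?_⟩
    · obtain ⟨x, hx, hle⟩ := hcof ⟨Order.succ γ, hα γ hγ⟩
      exact ⟨x, hx, Order.succ_le_iff.1 hle⟩
    · refine hcl (d := {x : Iio α | (x : Ordinal) ∈ C ∧ (x : Ordinal) < β}) (fun x hx => hx.1)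
        ?_ (.of_linearOrder _) (a := ⟨β, hβ⟩) ⟨fun x hx => hx.2.le, fun x hx => ?_⟩
      · obtain ⟨δ, hδ, -, hlt⟩ := h 0 (pos_iff_ne_zero.2 h0)
        exact ⟨⟨δ, hs hδ⟩, hδ, hlt⟩
      · by_contra hlt
        obtain ⟨δ, hδ, h1, h2⟩ := h x.1 (not_le.1 hlt)
        exact absurd (show δ ≤ x.1 from hx (show (⟨δ, hs hδ⟩ : Iio α) ∈ _ from ⟨hδ, h2⟩))
          (not_le.2 h1)
  · rintro ⟨hs, hub, hcl⟩
    refine ⟨hs, ?_, fun x => ?_⟩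
    · intro d hd hne _ a ha
      by_cases had : a ∈ d
      · exact hd had
      have hlt : ∀ x ∈ d, x < a := fun x hx => lt_of_le_of_ne (ha.1 hx) fun h => had (h ▸ hx)
      refine hcl a.1 a.2 ?_ fun γ hγ => ?_
      · obtain ⟨x, hx⟩ := hne
        exact ((zero_le (a := x.1)).trans_lt (hlt x hx)).ne'
      · by_contra! hno
        have : a ≤ ⟨γ, hγ.trans a.2⟩ := ha.2 fun x hx => by
          by_contra hx'
          exact absurd (hlt x hx) (not_lt.2 (hno x.1 (hd hx) (not_le.1 hx')))
        exact absurd (show a.1 ≤ γ from this) (not_le.2 hγ)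
    · obtain ⟨δ, hδ, h⟩ := hub x.1 x.2
      exact ⟨⟨δ, hs hδ⟩, hδ, h.le⟩

/-! ### Bounds and closure points below a regular cardinal -/

section Regular

variable {κ : Cardinal.{u}}

theorem Cardinal.IsRegular.succ_lt_ord (hκ : κ.IsRegular) {γ : Ordinal.{u}} (hγ : γ < κ.ord) :
    Order.succ γ < κ.ord :=
  (isSuccLimit_ord hκ.aleph0_le).succ_lt hγ

/-- Fewer than `κ` ordinals below a regular `κ` are bounded below `κ`. -/
theorem Cardinal.IsRegular.exists_bound (hκ : κ.IsRegular) {ι : Type*} [Small.{u} ι]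
    (hι : Cardinal.lift.{u} #ι < Cardinal.lift κ) (F : ι → Ordinal.{u})
    (hF : ∀ i, F i < κ.ord) : ∃ δ < κ.ord, ∀ i, F i < δ := by
  refine ⟨⨆ i, Order.succ (F i), ?_, fun i => ?_⟩
  · refine Ordinal.lift_iSup_lt_of_lt_cof ?_ fun i => hκ.succ_lt_ord (hF i)
    rw [← Ordinal.lift_cof, hκ.cof_ord]
    exact hι
  · exact (Order.lt_succ _).trans_le (Ordinal.le_iSup (fun i => Order.succ (F i)) i)

theorem Cardinal.IsRegular.exists_bound_Iio (hκ : κ.IsRegular) {α : Ordinal.{u}} (hα : α < κ.ord)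
    (F : Ordinal.{u} → Ordinal.{u}) (hF : ∀ i < α, F i < κ.ord) :
    ∃ δ < κ.ord, ∀ i < α, F i < δ := by
  obtain ⟨δ, hδ, h⟩ := hκ.exists_bound (ι := Iio α) (by
    rw [Cardinal.mk_Iio_ordinal, Cardinal.lift_lift, Cardinal.lift_lt]
    exact Cardinal.lt_ord.1 hα) (fun i => F i) fun i => hF i i.2
  exact ⟨δ, hδ, fun i hi => h ⟨i, hi⟩⟩

theorem mem_acc_ord_iff (hκ : κ.IsRegular) {α : Ordinal.{u}} :
    α ∈ acc (Iio κ.ord) ↔ α ≠ 0 ∧ α < κ.ord ∧ ∀ γ < α, Order.succ γ < α := by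
  refine and_congr_right fun h0 => ?_
  constructor
  · rintro ⟨⟨γ, hγ, hlt⟩, h⟩
    exact ⟨hlt.trans hγ, fun γ hγ => (h γ hγ).elim fun δ hδ =>
      (Order.succ_le_of_lt hδ.2.1).trans_lt hδ.2.2⟩
  · rintro ⟨hlt, h⟩
    exact ⟨⟨_, hκ.succ_lt_ord hlt, Order.lt_succ _⟩, fun γ hγ =>
      ⟨_, (h γ hγ).trans hlt, Order.lt_succ _, h γ hγ⟩⟩

/-- The closure points of a function on an uncountable regular `κ` are unbounded in `κ`. -/
theorem exists_closure_point (hκ : κ.IsRegular) (hunc : ℵ₀ < κ) (G : Ordinal.{u} → Ordinal.{u})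
    (hG : ∀ ξ < κ.ord, G ξ < κ.ord) {ξ₀ : Ordinal.{u}} (h₀ : ξ₀ < κ.ord) :
    ∃ α ∈ acc (Iio κ.ord), ξ₀ < α ∧ ∀ ξ < α, G ξ < α := by
  -- The closure point is the supremum of the iterates of such a choice; it stays below `κ` because
  -- `κ` has uncountable cofinality.
  have step : ∀ ξ : Ordinal.{u}, ∃ η, ξ < κ.ord → ξ < η ∧ η < κ.ord ∧ ∀ ζ < ξ, G ζ < η := by
    intro ξ
    by_cases hξ : ξ < κ.ord
    · obtain ⟨δ, hδ, h⟩ := hκ.exists_bound_Iio hξ G fun i hi => hG i (hi.trans hξ)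
      exact ⟨max δ (Order.succ ξ), fun _ => ⟨(Order.lt_succ ξ).trans_le (le_max_right _ _),
        max_lt hδ (hκ.succ_lt_ord hξ), fun ζ hζ => (h ζ hζ).trans_le (le_max_left _ _)⟩⟩
    · exact ⟨0, fun h => absurd h hξ⟩
  choose N hN using step
  have hlt : ∀ n, N^[n] ξ₀ < κ.ord := fun n => by
    induction n with
    | zero => exact h₀
    | succ n ih => rw [Function.iterate_succ_apply']; exact (hN _ ih).2.1
  have hle : ∀ n, N^[n] ξ₀ < ⨆ n, N^[n] ξ₀ := fun n => by
    refine (hN _ (hlt n)).1.trans_le ?_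
    rw [← Function.iterate_succ_apply' N n ξ₀]
    exact Ordinal.le_iSup (fun n => N^[n] ξ₀) (n + 1)
  have key : ∀ ξ < ⨆ n, N^[n] ξ₀, ∃ n, ξ < N^[n] ξ₀ := fun ξ hξ => Ordinal.lt_iSup_iff.1 hξ
  refine ⟨⨆ n, N^[n] ξ₀, (mem_acc_ord_iff hκ).2 ⟨?_, ?_, fun γ hγ => ?_⟩, hle 0, fun ξ hξ => ?_⟩
  · exact ((zero_le (a := _)).trans_lt (hle 0)).ne'
  · refine Ordinal.lift_iSup_lt_of_lt_cof ?_ hlt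
    rw [← Ordinal.lift_cof, hκ.cof_ord]
    simpa using hunc
  · obtain ⟨n, hn⟩ := key γ hγ
    exact (Order.succ_le_of_lt hn).trans_lt (hle n)
  · obtain ⟨n, hn⟩ := key ξ hξ
    refine ((hN _ (hlt n)).2.2 ξ hn).trans ?_
    rw [← Function.iterate_succ_apply' N n ξ₀]
    exact hle (n + 1)

end Regular

/-! ### Stationary values from a square sequence -/

theorem acc_mono {A B : Set Ordinal.{u}} (h : A ⊆ B) : acc A ⊆ acc B :=
  fun _ ⟨h0, ⟨γ, hγ, hlt⟩, h'⟩ => ⟨h0, ⟨γ, h hγ, hlt⟩, fun ξ hξ =>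
    (h' ξ hξ).elim fun δ hδ => ⟨δ, h hδ.1, hδ.2⟩⟩

theorem acc_mem_trans {A : Set Ordinal.{u}} {α β : Ordinal.{u}} (hα : α ∈ acc A) (hβ : β ∈ acc A)
    (hlt : α < β) : α ∈ acc (A ∩ Iio β) := by
  refine ⟨hα.1, ?_, fun γ hγ => ?_⟩
  · obtain ⟨δ, hδ, h1, h2⟩ := hβ.2.2 α hlt
    exact ⟨δ, ⟨hδ, h2⟩, h1⟩
  · obtain ⟨δ, hδ, h1, h2⟩ := hα.2.2 γ hγ
    exact ⟨δ, ⟨hδ, h2.trans hlt⟩, h1, h2⟩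

section

variable {κ : Cardinal.{u}} {C : Ordinal.{u} → Set Ordinal.{u}}

/-- In a `□(κ)`-sequence, the first element past a suitable `ε` takes unboundedly many values
on stationary sets. -/
theorem IsSquareSeq.exists_stationary_values (hκ : κ.IsRegular) (hunc : ℵ₀ < κ)
    (hC : IsSquareSeq κ C) :
    ∃ ε < κ.ord, ∀ δ < κ.ord, ∃ i < κ.ord, δ ≤ i ∧ ∀ E, IsClubSubset E κ.ord →
      ∃ α ∈ E, α ∈ acc (Iio κ.ord) ∧ ε < α ∧ sInf (C α \ Iio ε) = i := by
  by_contra! hno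
  have hclub : ∀ α ∈ acc (Iio κ.ord), _ := fun α hα =>
    (isClubSubset_iff ((mem_acc_ord_iff hκ).1 hα).2.2).1 (hC.club α hα)
  have hκsucc : ∀ γ < κ.ord, Order.succ γ < κ.ord := fun γ hγ => hκ.succ_lt_ord hγ
  -- bounds for the stationary values and clubs avoiding the other ones
  have h1 : ∀ ε : Ordinal.{u}, ∃ δ, ε < κ.ord → δ < κ.ord ∧ ∀ i < κ.ord, δ ≤ i →
      ∃ E, IsClubSubset E κ.ord ∧ ∀ α ∈ E, α ∈ acc (Iio κ.ord) → ε < α →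
        sInf (C α \ Iio ε) ≠ i := fun ε => by
    by_cases hε : ε < κ.ord
    · obtain ⟨δ, h⟩ := hno ε hε
      exact ⟨δ, fun _ => h⟩
    · exact ⟨0, fun h => absurd h hε⟩
  choose δ hδ using h1
  have h2 : ∀ ε i : Ordinal.{u}, ∃ E, ε < κ.ord → i < κ.ord → δ ε ≤ i →
      IsClubSubset E κ.ord ∧ ∀ α ∈ E, α ∈ acc (Iio κ.ord) → ε < α →
        sInf (C α \ Iio ε) ≠ i := fun ε i => by
    by_cases h : ε < κ.ord ∧ i < κ.ord ∧ δ ε ≤ i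
    · obtain ⟨E, hE⟩ := (hδ ε h.1).2 i h.2.1 h.2.2
      exact ⟨E, fun _ _ _ => hE⟩
    · exact ⟨∅, fun a b c => absurd ⟨a, b, c⟩ h⟩
  choose E hE using h2
  have h3 : ∀ ε i ξ : Ordinal.{u}, ∃ η, ε < κ.ord → i < κ.ord → δ ε ≤ i → ξ < κ.ord →
      η ∈ E ε i ∧ ξ < η ∧ η < κ.ord := fun ε i ξ => by
    by_cases h : ε < κ.ord ∧ i < κ.ord ∧ δ ε ≤ i ∧ ξ < κ.ord
    · obtain ⟨hc, -⟩ := hE ε i h.1 h.2.1 h.2.2.1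
      rw [isClubSubset_iff hκsucc] at hc
      obtain ⟨η, hη, hlt⟩ := hc.2.1 ξ h.2.2.2
      exact ⟨η, fun _ _ _ _ => ⟨hη, hlt, hc.1 hη⟩⟩
    · exact ⟨0, fun a b c d => absurd ⟨a, b, c, d⟩ h⟩
  choose N hN using h3
  -- `G` diagonalizes: a limit ordinal closed under `G` is a limit of `E ε i` for all smaller `ε`
  -- and `i` with `δ ε ≤ i`.
  have h4 : ∀ ξ : Ordinal.{u}, ∃ η, ξ < κ.ord → η < κ.ord ∧ δ ξ < η ∧
      ∀ ε < ξ, ∀ i < ξ, δ ε ≤ i → N ε i ξ < η := fun ξ => by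
    by_cases hξ : ξ < κ.ord
    · have h5 : ∀ ε : Ordinal.{u}, ∃ b, ε < ξ → b < κ.ord ∧ ∀ i < ξ, δ ε ≤ i → N ε i ξ < b :=
        fun ε => by
          by_cases hε : ε < ξ
          · obtain ⟨b, hb, h⟩ := hκ.exists_bound_Iio hξ
              (fun i => if δ ε ≤ i then N ε i ξ else 0) fun i hi => by
                split_ifs with h
                · exact (hN ε i ξ (hε.trans hξ) (hi.trans hξ) h hξ).2.2
                · exact hκ.ord_pos
            refine ⟨b, fun _ => ⟨hb, fun i hi hle => ?_⟩⟩
            simpa [hle] using h i hi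
          · exact ⟨0, fun h => absurd h hε⟩
      choose b hb using h5
      obtain ⟨c, hc, h⟩ := hκ.exists_bound_Iio hξ b fun ε hε => (hb ε hε).1
      refine ⟨max c (Order.succ (δ ξ)), fun _ => ⟨max_lt hc (hκsucc _ (hδ ξ hξ).1),
        (Order.lt_succ _).trans_le (le_max_right _ _), fun ε hε i hi hle => ?_⟩⟩
      exact (((hb ε hε).2 i hi hle).trans (h ε hε)).trans_le (le_max_left _ _)
    · exact ⟨0, fun h => absurd h hξ⟩
  choose G hG using h4
  -- accumulation of the closure points of `G`
  have key : ∀ γ ∈ acc (Iio κ.ord), ∀ α ∈ acc (Iio κ.ord), (∀ ξ < γ, G ξ < γ) →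
      (∀ ξ < α, G ξ < α) → γ < α → C α ∩ Iio γ = C γ := by
    intro γ hγ α hα hγG hαG hlt
    have hα' := (mem_acc_ord_iff hκ).1 hα
    refine hC.coherent γ hγ α hα ⟨hγ.1, ?_, fun ε hε => ?_⟩
    · exact (hclub α hα).2.1 γ hlt
    have hε' := ((mem_acc_ord_iff hκ).1 hγ).2.2 ε hε
    -- Passing to the successor makes the first element of `C α` from `ε'` on strictly larger than
    -- `ε`.
    set ε' := Order.succ ε
    have hne : (C α \ Iio ε').Nonempty := by
      obtain ⟨x, hx, h⟩ := (hclub α hα).2.1 ε' (hε'.trans hlt)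
      exact ⟨x, hx, not_lt.2 h.le⟩
    have hmem := csInf_mem hne
    set i := sInf (C α \ Iio ε') with hi
    have hiα : i < α := (hclub α hα).1 hmem.1
    have hε'κ := (hε'.trans hlt).trans hα'.2.1
    -- Otherwise `α`, being a limit of the club `E ε' i`, belongs to it, and that club avoids the
    -- value `i`.
    have hiδ : i < δ ε' := by
      by_contra! hle
      obtain ⟨hc, havoid⟩ := hE ε' i hε'κ (hiα.trans hα'.2.1) hle
      rw [isClubSubset_iff hκsucc] at hc
      refine havoid α (hc.2.2 α hα'.2.1 hα'.1 fun ξ hξ => ?_) hα (hε'.trans hlt) hi.symm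
      set ζ := max ξ (Order.succ (max ε' i))
      have hζ : ζ < α := max_lt hξ (hα'.2.2 _ (max_lt (hε'.trans hlt) hiα))
      have hζκ := hζ.trans hα'.2.1
      have hs : max ε' i < ζ := (Order.lt_succ _).trans_le (le_max_right _ _)
      obtain ⟨m1, m2, -⟩ := hN ε' i ζ hε'κ (hiα.trans hα'.2.1) hle hζκ
      exact ⟨_, m1, (le_max_left _ _).trans_lt m2, ((hG ζ hζκ).2.2 ε'
        ((le_max_left _ _).trans_lt hs) i ((le_max_right _ _).trans_lt hs) hle).trans (hαG ζ hζ)⟩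
    exact ⟨i, hmem.1, (Order.lt_succ ε).trans_le (not_lt.1 hmem.2),
      (hiδ.trans (hG ε' hε'κ).2.1).trans (hγG ε' hε')⟩
  have hclos : ∀ ξ < κ.ord, _ := fun ξ hξ =>
    exists_closure_point hκ hunc G (fun ξ hξ => (hG ξ hξ).1) hξ
  -- the union of the `C γ` is a thread
  let D : Set Ordinal.{u} := {x | ∃ γ ∈ acc (Iio κ.ord), (∀ ξ < γ, G ξ < γ) ∧ x ∈ C γ}
  have hD : ∀ γ ∈ acc (Iio κ.ord), (∀ ξ < γ, G ξ < γ) → D ∩ Iio γ = C γ := by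
    intro γ hγ hγG
    ext x
    constructor
    · rintro ⟨⟨α, hα, hαG, hx⟩, hxγ⟩
      rcases lt_trichotomy γ α with h | rfl | h
      · rw [← key γ hγ α hα hγG hαG h]; exact ⟨hx, hxγ⟩
      · exact hx
      · rw [← key α hα γ hγ hαG hγG h] at hx; exact hx.1
    · exact fun hx => ⟨⟨γ, hγ, hγG, hx⟩, (hclub γ hγ).1 hx⟩
  refine hC.no_thread ⟨D, (isClubSubset_iff hκsucc).2 ⟨?_, fun γ hγ => ?_,
    fun β hβ h0 h => ?_⟩, fun α hα => ?_⟩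
  · rintro x ⟨γ, hγ, -, hx⟩
    exact ((hclub γ hγ).1 hx).trans ((mem_acc_ord_iff hκ).1 hγ).2.1
  · obtain ⟨α, hα, hlt, hαG⟩ := hclos γ hγ
    obtain ⟨x, hx, h⟩ := (hclub α hα).2.1 γ hlt
    exact ⟨x, ⟨α, hα, hαG, hx⟩, h⟩
  · obtain ⟨α, hα, hlt, hαG⟩ := hclos β hβ
    refine ⟨α, hα, hαG, (hclub α hα).2.2 β hlt h0 fun γ hγ => ?_⟩
    obtain ⟨x, hx, h1, h2⟩ := h γ hγ
    exact ⟨x, by rw [← hD α hα hαG]; exact ⟨hx, h2.trans hlt⟩, h1, h2⟩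
  -- `α` need not be closed under `G`; coherence is applied at a closure point `γ > α`, below which
  -- `D` is `C γ`.
  · obtain ⟨x, ⟨γ₀, hγ₀, -, hx⟩, hαx⟩ := hα.2.1
    have hακ : α < κ.ord := hαx.trans (((hclub γ₀ hγ₀).1 hx).trans ((mem_acc_ord_iff hκ).1 hγ₀).2.1)
    obtain ⟨γ, hγ, hlt, hγG⟩ := hclos α hακ
    have hacc : α ∈ acc (C γ) := by
      refine ⟨hα.1, (hclub γ hγ).2.1 α hlt, fun ξ hξ => ?_⟩
      obtain ⟨y, hy, h1, h2⟩ := hα.2.2 ξ hξ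
      exact ⟨y, by rw [← hD γ hγ hγG]; exact ⟨hy, h2.trans hlt⟩, h1, h2⟩
    have hαlim : α ∈ acc (Iio κ.ord) :=
      ⟨hα.1, ⟨γ, ((mem_acc_ord_iff hκ).1 hγ).2.1, hlt⟩, fun ξ hξ => by
        obtain ⟨y, -, h1, h2⟩ := hα.2.2 ξ hξ
        exact ⟨y, h2.trans hακ, h1, h2⟩⟩
    rw [← hC.coherent α hαlim γ hγ hacc, ← hD γ hγ hγG, inter_assoc, Iio_inter_Iio,
      min_eq_right hlt.le]

end

/-! ### Colored C-sequences -/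

/-- A coherent `C`-sequence on `κ`, together with a coloring that is constant along the
accumulation points of each of its members. -/
structure IsColoredCSeq (κ : Cardinal.{u}) (D : Ordinal.{u} → Set Ordinal.{u})
    (h : Ordinal.{u} → Ordinal.{u}) : Prop where
  subset : ∀ β < κ.ord, D β ⊆ Iio β
  cofinal : ∀ β < κ.ord, ∀ ξ < β, ∃ e ∈ D β, ξ ≤ e
  closed : ∀ β < κ.ord, acc (D β) ⊆ D β
  unbounded_or_singleton : ∀ β < κ.ord, ∀ e ∈ D β, (∃ e' ∈ D β, e < e') ∨ D β = {e}
  coherent : ∀ β < κ.ord, ∀ α ∈ acc (D β), D β ∩ Iio α = D α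
  color_eq : ∀ β < κ.ord, ∀ α ∈ acc (D β), h α = h β

theorem acc_singleton (η : Ordinal.{u}) : acc {η} = ∅ := by
  refine eq_empty_of_forall_notMem ?_
  rintro α ⟨h0, ⟨_, rfl, hlt⟩, h⟩
  obtain ⟨δ, rfl, -, h2⟩ := h 0 (pos_iff_ne_zero.2 h0)
  exact absurd h2 hlt.not_gt

/-- The color of `α` is a recoding into `lam` of the first element of `C α` from `ε` on. Coherence
preserves that element at accumulation points, and each of `lam` many of its values is taken on a
stationary set. -/
theorem Square.exists_coloredCSeq {lam κ : Cardinal.{u}} (hκ : κ.IsRegular) (hunc : ℵ₀ < κ)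
    (hlam : lam.IsRegular) (hlt : lam < κ) (hsq : Square κ) :
    ∃ D h, IsColoredCSeq κ D h ∧ (∀ α, h α < lam.ord) ∧
      ∀ j < lam.ord, ∀ E, IsClubSubset E κ.ord → ∃ α ∈ E, j < h α := by
  classical
  obtain ⟨C, hC⟩ := hsq
  obtain ⟨ε, hε, hval⟩ := hC.exists_stationary_values hκ hunc
  have hclub : ∀ α ∈ acc (Iio κ.ord), _ := fun α hα =>
    (isClubSubset_iff ((mem_acc_ord_iff hκ).1 hα).2.2).1 (hC.club α hα)
  let W : Set Ordinal.{u} := {i | i < κ.ord ∧ ∀ E, IsClubSubset E κ.ord →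
      ∃ α ∈ E, α ∈ acc (Iio κ.ord) ∧ ε < α ∧ sInf (C α \ Iio ε) = i}
  have : Small.{u} W := small_subset (show W ⊆ Iio κ.ord from fun i hi => hi.1)
  have hW : #(Iio lam.ord) ≤ #W := by
    have : ¬ Cardinal.lift.{u} #W < Cardinal.lift.{u + 1} κ := fun hcard => by
      obtain ⟨δ, hδ, h⟩ := hκ.exists_bound hcard (fun i => i.1) fun i => i.2.1
      obtain ⟨i, hi, hle, h'⟩ := hval δ hδ
      exact absurd (h ⟨i, hi, h'⟩) (not_lt.2 hle)
    rw [not_lt, Cardinal.lift_id'.{u, u + 1}] at this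
    rw [Cardinal.mk_Iio_ordinal, card_ord]
    exact (Cardinal.lift_le.2 hlt.le).trans this
  obtain ⟨e⟩ : Nonempty (Iio lam.ord ↪ W) := by
    rwa [← Cardinal.le_def]
  -- A left inverse of `e`, with default `0` off its range.
  let g : Ordinal.{u} → Ordinal.{u} := fun i =>
    if h : ∃ j, (e j : Ordinal) = i then h.choose else 0
  have hg : ∀ j, g (e j) = j := fun j => by
    have h : ∃ j', (e j' : Ordinal) = e j := ⟨j, rfl⟩
    simp only [g, dif_pos h]
    exact congrArg _ (e.injective (Subtype.ext h.choose_spec))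
  have hglt : ∀ i, g i < lam.ord := fun i => by
    simp only [g]
    split_ifs with h
    · exact h.choose.2
    · exact hlam.ord_pos
  -- For a limit `α > ε` the cut makes the least element of `D α` the value to be recoded. A
  -- successor gets its predecessor as only element, and `0` gets the empty set.
  let D : Ordinal.{u} → Set Ordinal.{u} := fun α =>
    if α ∈ acc (Iio κ.ord) then if ε < α then C α \ Iio ε else C α
    else {η | Order.succ η = α}
  let h : Ordinal.{u} → Ordinal.{u} := fun α => if ε < α then g (sInf (D α)) else 0
  have hDsucc : ∀ η, D (Order.succ η) = {η} := fun η => by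
    have : Order.succ η ∉ acc (Iio κ.ord) := fun h =>
      absurd (((mem_acc_ord_iff hκ).1 h).2.2 η (Order.lt_succ η)) (lt_irrefl _)
    simp only [D, if_neg this]
    ext x
    exact Order.succ_eq_succ_iff
  have hDzero : D 0 = ∅ := by
    have : (0 : Ordinal) ∉ acc (Iio κ.ord) := fun h => h.1 rfl
    simp only [D, if_neg this]
    exact eq_empty_of_forall_notMem fun x hx => Order.succ_ne_bot x hx
  have hDε : ∀ α ∈ acc (Iio κ.ord), ε < α → D α = C α \ Iio ε := fun α hα h => by
    simp only [D, if_pos hα, if_pos h]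
  have hDε' : ∀ α ∈ acc (Iio κ.ord), ¬ ε < α → D α = C α := fun α hα h => by
    simp only [D, if_pos hα, if_neg h]
  have hDsub : ∀ α ∈ acc (Iio κ.ord), D α ⊆ C α := fun α hα => by
    by_cases hlt : ε < α
    · rw [hDε α hα hlt]; exact sdiff_subset
    · rw [hDε' α hα hlt]
  have hcases : ∀ β < κ.ord, β = 0 ∨ (∃ η, Order.succ η = β) ∨ β ∈ acc (Iio κ.ord) := by
    intro β hβ
    by_cases h0 : β = 0
    · exact .inl h0
    · by_cases hs : ∃ η, Order.succ η = β
      · exact .inr (.inl hs)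
      · refine .inr (.inr ((mem_acc_ord_iff hκ).2 ⟨h0, hβ, fun γ hγ => ?_⟩))
        exact lt_of_le_of_ne (Order.succ_le_of_lt hγ) fun h => hs ⟨γ, h⟩
  have hDub : ∀ β ∈ acc (Iio κ.ord), ∀ ξ < β, ∃ e ∈ D β, ξ < e := fun β hβ ξ hξ => by
    by_cases hlt : ε < β
    · obtain ⟨x, hx, h⟩ := (hclub β hβ).2.1 _ (max_lt hξ hlt)
      exact ⟨x, by rw [hDε β hβ hlt]; exact ⟨hx, not_lt.2 ((le_max_right _ _).trans h.le)⟩,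
        (le_max_left _ _).trans_lt h⟩
    · rw [hDε' β hβ hlt]; exact (hclub β hβ).2.1 ξ hξ
  have hacc : ∀ β < κ.ord, ∀ α ∈ acc (D β), β ∈ acc (Iio κ.ord) ∧ α < β ∧
      α ∈ acc (Iio κ.ord) ∧ α ∈ acc (C β) ∧ (ε < β → ε < α) := by
    intro β hβ α hα
    rcases hcases β hβ with rfl | ⟨η, rfl⟩ | hlim
    · rw [hDzero] at hα
      exact hα.2.1.elim fun _ h => h.1.elim
    · rw [hDsucc, acc_singleton] at hα
      exact hα.elim
    · have hαβ : α < β := hα.2.1.elim fun x hx => hx.2.trans ((hclub β hlim).1 (hDsub β hlim hx.1))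
      refine ⟨hlim, hαβ, ⟨hα.1, ⟨β, hβ, hαβ⟩, fun ξ hξ => ?_⟩, acc_mono (hDsub β hlim) hα,
        fun hεβ => ?_⟩
      · obtain ⟨x, -, h1, h2⟩ := hα.2.2 ξ hξ
        exact ⟨x, h2.trans (hαβ.trans hβ), h1, h2⟩
      · obtain ⟨x, hx, -, h2⟩ := hα.2.2 0 (pos_iff_ne_zero.2 hα.1)
        rw [hDε β hlim hεβ] at hx
        exact (not_lt.1 hx.2).trans_lt h2
  have hcoh : ∀ β < κ.ord, ∀ α ∈ acc (D β), D β ∩ Iio α = D α := by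
    intro β hβ α hα
    obtain ⟨hlim, hαβ, hαlim, hαC, hεα⟩ := hacc β hβ α hα
    have := hC.coherent α hαlim β hlim hαC
    by_cases hεβ : ε < β
    · rw [hDε β hlim hεβ, hDε α hαlim (hεα hεβ), ← this]
      ext x
      exact and_right_comm
    · rw [hDε' β hlim hεβ, hDε' α hαlim fun h => hεβ (h.trans hαβ), this]
  refine ⟨D, h, ⟨fun β hβ => ?_, fun β hβ ξ hξ => ?_, fun β hβ α hα => ?_, fun β hβ e he => ?_,
    hcoh, fun β hβ α hα => ?_⟩, fun α => ?_, fun j hj E hE => ?_⟩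
  · rcases hcases β hβ with rfl | ⟨η, rfl⟩ | hlim
    · simp [hDzero]
    · rw [hDsucc]; rintro _ rfl; exact Order.lt_succ (α := Ordinal) _
    · exact (hDsub β hlim).trans (hclub β hlim).1
  · rcases hcases β hβ with rfl | ⟨η, rfl⟩ | hlim
    · exact absurd hξ not_lt_zero
    · exact ⟨η, by rw [hDsucc]; rfl, Order.lt_succ_iff.1 hξ⟩
    · obtain ⟨x, hx, h⟩ := hDub β hlim ξ hξ
      exact ⟨x, hx, h.le⟩
  · obtain ⟨hlim, hαβ, hαlim, hαC, hεα⟩ := hacc β hβ α hα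
    have hmem : α ∈ C β := (hclub β hlim).2.2 α hαβ hα.1 hαC.2.2
    by_cases hεβ : ε < β
    · rw [hDε β hlim hεβ]; exact ⟨hmem, not_lt.2 (hεα hεβ).le⟩
    · rwa [hDε' β hlim hεβ]
  · rcases hcases β hβ with rfl | ⟨η, rfl⟩ | hlim
    · rw [hDzero] at he; exact he.elim
    · right; rw [hDsucc] at he ⊢; rw [mem_singleton_iff.1 he]
    · exact .inl (hDub β hlim e ((hclub β hlim).1 (hDsub β hlim he)))
  · obtain ⟨hlim, hαβ, hαlim, hαC, hεα⟩ := hacc β hβ α hα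
    by_cases hεβ : ε < β
    · simp only [h, if_pos hεβ, if_pos (hεα hεβ)]
      congr 1
      rw [← hcoh β hβ α hα]
      obtain ⟨x, hx, -, h2⟩ := hα.2.2 0 (pos_iff_ne_zero.2 hα.1)
      have hm := csInf_mem (⟨x, hx, h2⟩ : (D β ∩ Iio α).Nonempty)
      refine le_antisymm (le_csInf ⟨x, hx⟩ fun y hy => ?_) (csInf_le' hm.1)
      by_cases hyα : y < α
      · exact csInf_le' ⟨hy, hyα⟩
      · exact hm.2.le.trans (not_lt.1 hyα)
    · simp only [h, if_neg hεβ, if_neg fun h' : ε < α => hεβ (h'.trans hαβ)]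
  · simp only [h]
    split_ifs
    · exact hglt _
    · exact hlam.ord_pos
  -- The color `succ j` occurs on every club, which makes the inequality strict.
  · obtain ⟨α, hαE, hα, hεα, hv⟩ := (e ⟨_, hlam.succ_lt_ord hj⟩).2.2 E hE
    refine ⟨α, hαE, ?_⟩
    simp only [h, if_pos hεα]
    rw [hDε α hα hεα, hv, hg]
    exact Order.lt_succ j

/-! ### Ladders and the function `rho` -/

/-- The accumulation points of `D β` if they are cofinal in `β`, and the part of `D β` past its
accumulation points otherwise. -/
def ladder (D : Ordinal.{u} → Set Ordinal.{u}) (β : Ordinal.{u}) : Set Ordinal.{u} :=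
  {e | e ∈ D β ∧ (((∀ ξ < β, ∃ δ ∈ acc (D β), ξ ≤ δ) ∧ e ∈ acc (D β)) ∨
    ((¬ ∀ ξ < β, ∃ δ ∈ acc (D β), ξ ≤ δ) ∧ ∀ δ ∈ acc (D β), δ ≤ e))}

/-- The pairs of elements of the ladder at `β` up to `e`. -/
def ladderPairs (D : Ordinal.{u} → Set Ordinal.{u}) (β e : Ordinal.{u}) :
    Set (Ordinal.{u} × Ordinal.{u}) :=
  {p | p.1 ∈ ladder D β ∧ p.2 ∈ ladder D β ∧ p.1 < p.2 ∧ p.2 ≤ e ∧ p.2 < β}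

open Classical in
/-- The subadditive function obtained by walking along the ladders. The larger ordinal is the
first argument. -/
noncomputable def rho (D : Ordinal.{u} → Set Ordinal.{u}) (h : Ordinal.{u} → Ordinal.{u})
    (β ξ : Ordinal.{u}) : Ordinal.{u} :=
  if ξ < β then
    max (max (h β) (⨆ p : ladderPairs D β (sInf {e | e ∈ ladder D β ∧ ξ ≤ e}),
      have : p.1.2 < β := p.2.2.2.2.2
      rho D h p.1.2 p.1.1))
      -- The test serves termination only: for `β < κ` the next ladder point is below `β`.
      (if _he : sInf {e | e ∈ ladder D β ∧ ξ ≤ e} < β then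
        rho D h (sInf {e | e ∈ ladder D β ∧ ξ ≤ e}) ξ else 0)
  else 0
termination_by β

/-- The value that `rho` picks up at the step of the ladder at `β` leading to `e`. -/
noncomputable def ladderBound (D : Ordinal.{u} → Set Ordinal.{u}) (h : Ordinal.{u} → Ordinal.{u})
    (β e : Ordinal.{u}) : Ordinal.{u} :=
  max (h β) (⨆ p : ladderPairs D β e, rho D h p.1.2 p.1.1)

section Rho

variable {κ : Cardinal.{u}} {D : Ordinal.{u} → Set Ordinal.{u}} {h : Ordinal.{u} → Ordinal.{u}}

theorem rho_of_le {β ξ : Ordinal.{u}} (hle : β ≤ ξ) : rho D h β ξ = 0 := by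
  rw [rho, if_neg (not_lt.2 hle)]

theorem rho_self (β : Ordinal.{u}) : rho D h β β = 0 :=
  rho_of_le le_rfl

theorem rho_eq {β ξ e : Ordinal.{u}} (he : e ∈ ladder D β) (heβ : e < β) (hξ : ξ ≤ e)
    (hmin : ∀ e' ∈ ladder D β, ξ ≤ e' → e ≤ e') :
    rho D h β ξ = max (ladderBound D h β e) (rho D h e ξ) := by
  have hinf : sInf {e | e ∈ ladder D β ∧ ξ ≤ e} = e :=
    le_antisymm (csInf_le' ⟨he, hξ⟩) (le_csInf ⟨e, he, hξ⟩ fun x hx => hmin x hx.1 hx.2)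
  subst hinf
  rw [rho, if_pos (hξ.trans_lt heβ), dif_pos heβ]
  rfl

instance small_ladderPairs (β e : Ordinal.{u}) : Small.{u} (ladderPairs D β e) :=
  small_subset (show ladderPairs D β e ⊆ Iio β ×ˢ Iio β from
    fun _ hp => ⟨hp.2.2.1.trans hp.2.2.2.2, hp.2.2.2.2⟩)

theorem color_le_ladderBound (β e : Ordinal.{u}) : h β ≤ ladderBound D h β e :=
  le_max_left _ _

theorem rho_le_ladderBound {β e e₁ e₂ : Ordinal.{u}} (h₁ : e₁ ∈ ladder D β) (h₂ : e₂ ∈ ladder D β)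
    (hlt : e₁ < e₂) (hle : e₂ ≤ e) (he : e₂ < β) : rho D h e₂ e₁ ≤ ladderBound D h β e :=
  (Ordinal.le_iSup (fun p : ladderPairs D β e => rho D h p.1.2 p.1.1)
    ⟨(e₁, e₂), h₁, h₂, hlt, hle, he⟩).trans (le_max_right _ _)

theorem ladderBound_le {β e x : Ordinal.{u}} (hx : h β ≤ x)
    (hp : ∀ e₁ ∈ ladder D β, ∀ e₂ ∈ ladder D β, e₁ < e₂ → e₂ ≤ e → e₂ < β → rho D h e₂ e₁ ≤ x) :
    ladderBound D h β e ≤ x :=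
  max_le hx (Ordinal.iSup_le fun p => hp _ p.2.1 _ p.2.2.1 p.2.2.2.1 p.2.2.2.2.1 p.2.2.2.2.2)

theorem ladderBound_mono {β e e' : Ordinal.{u}} (hle : e ≤ e') :
    ladderBound D h β e ≤ ladderBound D h β e' :=
  ladderBound_le (color_le_ladderBound _ _) fun _ h₁ _ h₂ hlt h₂e hβ =>
    rho_le_ladderBound h₁ h₂ hlt (h₂e.trans hle) hβ

namespace IsColoredCSeq

variable (hD : IsColoredCSeq κ D h)
include hD

theorem ladder_lt {β e : Ordinal.{u}} (hβ : β < κ.ord) (he : e ∈ ladder D β) : e < β :=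
  hD.subset β hβ he.1

theorem ladder_cofinal {β ξ : Ordinal.{u}} (hβ : β < κ.ord) (hξ : ξ < β) :
    ∃ e ∈ ladder D β, ξ ≤ e := by
  by_cases hP : ∀ ξ < β, ∃ δ ∈ acc (D β), ξ ≤ δ
  · obtain ⟨δ, hδ, hle⟩ := hP ξ hξ
    exact ⟨δ, ⟨hD.closed β hβ hδ, .inl ⟨hP, hδ⟩⟩, hle⟩
  · have hP' := hP
    push Not at hP'
    obtain ⟨ξ₀, hξ₀, h₀⟩ := hP'
    obtain ⟨e, he, hle⟩ := hD.cofinal β hβ _ (max_lt hξ hξ₀)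
    exact ⟨e, ⟨he, .inr ⟨hP, fun δ hδ => (h₀ δ hδ).le.trans ((le_max_right _ _).trans hle)⟩⟩,
      (le_max_left _ _).trans hle⟩

theorem exists_step {β ξ : Ordinal.{u}} (hβ : β < κ.ord) (hξ : ξ < β) :
    ∃ e ∈ ladder D β, e < β ∧ ξ ≤ e ∧ ∀ e' ∈ ladder D β, ξ ≤ e' → e ≤ e' := by
  obtain ⟨e, he, hle⟩ := hD.ladder_cofinal hβ hξ
  have hm := csInf_mem (⟨e, he, hle⟩ : {e | e ∈ ladder D β ∧ ξ ≤ e}.Nonempty)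
  exact ⟨_, hm.1, hD.ladder_lt hβ hm.1, hm.2, fun e' he' hle' => csInf_le' ⟨he', hle'⟩⟩

theorem color_le_rho {β ξ : Ordinal.{u}} (hβ : β < κ.ord) (hξ : ξ < β) : h β ≤ rho D h β ξ := by
  obtain ⟨e, he, heβ, hξe, hmin⟩ := hD.exists_step hβ hξ
  rw [rho_eq he heβ hξe hmin]
  exact (color_le_ladderBound _ _).trans (le_max_left _ _)

theorem acc_trans {β γ δ : Ordinal.{u}} (hβ : β < κ.ord) (hδ : δ ∈ acc (D β))
    (hγ : γ ∈ acc (D β)) (hlt : δ < γ) : δ ∈ acc (D γ) := by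
  rw [← hD.coherent β hβ γ hγ]
  exact acc_mem_trans hδ hγ hlt

/-- By induction and coherence, pairs of accumulation points of `D β` all have value `h β`. The
first step from `β` towards `δ` leads to an accumulation point and absorbs at most such pairs. -/
theorem rho_acc {β : Ordinal.{u}} (hβ : β < κ.ord) :
    ∀ δ ∈ acc (D β), rho D h β δ = h β := by
  induction β using WellFoundedLT.induction with
  | ind β ih =>
  intro δ hδ
  have hδβ := hD.subset β hβ (hD.closed β hβ hδ)
  refine le_antisymm ?_ (hD.color_le_rho hβ hδβ)
  have hpair : ∀ γ ∈ acc (D β), ∀ δ ∈ acc (D β), δ < γ → rho D h γ δ = h β := fun γ hγ δ hδ hlt => by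
    have hγβ := hD.subset β hβ (hD.closed β hβ hγ)
    rw [ih γ hγβ (hγβ.trans hβ) δ (hD.acc_trans hβ hδ hγ hlt), hD.color_eq β hβ γ hγ]
  obtain ⟨e, he, heβ, hδe, hmin⟩ := hD.exists_step hβ hδβ
  suffices e ∈ acc (D β) ∧ ladderBound D h β e ≤ h β by
    rw [rho_eq he heβ hδe hmin]
    refine max_le this.2 ?_
    rcases hδe.eq_or_lt with rfl | hlt
    · rw [rho_self]; exact zero_le
    · exact (hpair e this.1 δ hδ hlt).le
  by_cases hP : ∀ ξ < β, ∃ δ ∈ acc (D β), ξ ≤ δ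
  · have hL : ∀ e ∈ ladder D β, e ∈ acc (D β) := fun e he =>
      he.2.elim (fun h => h.2) fun h => absurd hP h.1
    exact ⟨hL e he, ladderBound_le le_rfl fun e₁ h₁ e₂ h₂ hlt _ _ =>
      (hpair e₂ (hL _ h₂) e₁ (hL _ h₁) hlt).le⟩
  · have hL : ∀ e ∈ ladder D β, ∀ δ ∈ acc (D β), δ ≤ e := fun e he =>
      he.2.elim (fun h => absurd h.1 hP) fun h => h.2
    -- Here every ladder point is at least `δ`, so `e` is the least one and no pair lies up to it.
    -- It remains to see that `e` is the largest accumulation point.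
    refine ⟨?_, ladderBound_le le_rfl fun e₁ h₁ e₂ _ hlt hle _ =>
      absurd (hmin e₁ h₁ (hL e₁ h₁ δ hδ)) (not_le.2 (hlt.trans_le hle))⟩
    have hbdd : BddAbove (acc (D β)) := ⟨e, hL e he⟩
    have hγe : sSup (acc (D β)) ≤ e := csSup_le ⟨δ, hδ⟩ (hL e he)
    suffices hγ : sSup (acc (D β)) ∈ acc (D β) by
      rwa [le_antisymm (hmin _ ⟨hD.closed β hβ hγ, .inr ⟨hP, fun δ hδ => le_csSup hbdd hδ⟩⟩
        (le_csSup hbdd hδ)) hγe]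
    by_contra hno
    refine hno ⟨((pos_iff_ne_zero.2 hδ.1).trans_le (le_csSup hbdd hδ)).ne', ?_, fun ξ hξ => ?_⟩
    · rcases hD.unbounded_or_singleton β hβ e he.1 with ⟨e', he', hlt⟩ | hs
      · exact ⟨e', he', hγe.trans_lt hlt⟩
      · rw [hs, acc_singleton] at hδ
        exact hδ.elim
    · obtain ⟨δ', hδ', hlt⟩ := exists_lt_of_lt_csSup ⟨δ, hδ⟩ hξ
      exact ⟨δ', hD.closed β hβ hδ', hlt,
        lt_of_le_of_ne (le_csSup hbdd hδ') fun h => hno (h ▸ hδ')⟩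

/-- Either `α` is an accumulation point of `D β`, or the ladder at `β` has a gap below `α`. -/
theorem acc_or_gap {α β : Ordinal.{u}} (hβ : β < κ.ord) (hαβ : α < β) (h0 : α ≠ 0) :
    α ∈ acc (D β) ∨ ∃ ζ < α, ∀ e ∈ ladder D β, ζ < e → α ≤ e := by
  refine or_iff_not_imp_right.2 fun hgap => ?_
  push Not at hgap
  refine ⟨h0, ?_, fun ζ hζ => ?_⟩
  · obtain ⟨e, he, hle⟩ := hD.ladder_cofinal hβ hαβ
    rcases hD.unbounded_or_singleton β hβ e he.1 with ⟨e', he', hlt⟩ | hs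
    · exact ⟨e', he', hle.trans_lt hlt⟩
    · obtain ⟨e', he', -, hlt⟩ := hgap 0 (pos_iff_ne_zero.2 h0)
      have := he'.1
      rw [hs] at this
      exact absurd (hle.trans_eq this.symm) (not_le.2 hlt)
  · obtain ⟨e, he, h1, h2⟩ := hgap ζ hζ
    exact ⟨e, he.1, h1, h2⟩

/-- Let the walks to `ξ` and `η` step first to `a` and `b`. If `a = b`, induction at `a` suffices.
Otherwise `a < η ≤ b`, and `rho b a` was absorbed into the bound at `b`; induction at `b` then
controls `rho η a`, and induction at `η` compares `rho η ξ` with `rho a ξ`. -/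
theorem rho_subadditive {β : Ordinal.{u}} (hβ : β < κ.ord) :
    ∀ η ≤ β, ∀ ξ ≤ η, rho D h β ξ ≤ max (rho D h η ξ) (rho D h β η) ∧
      rho D h η ξ ≤ max (rho D h β ξ) (rho D h β η) := by
  induction β using WellFoundedLT.induction with
  | ind β ih =>
  intro η hη ξ hξ
  rcases hη.eq_or_lt with rfl | hηβ
  · simp
  obtain ⟨a, ha, haβ, hξa, hamin⟩ := hD.exists_step hβ (hξ.trans_lt hηβ)
  obtain ⟨b, hb, hbβ, hηb, hbmin⟩ := hD.exists_step hβ hηβ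
  have hab : a ≤ b := hamin b hb (hξ.trans hηb)
  have hc : ladderBound D h β a ≤ ladderBound D h β b := ladderBound_mono hab
  rw [rho_eq ha haβ hξa hamin, rho_eq hb hbβ hηb hbmin]
  rcases hab.eq_or_lt with rfl | hlt
  · obtain ⟨i1, i2⟩ := ih a haβ (haβ.trans hβ) η hηb ξ hξ
    grind
  · have haη : a < η := by
      by_contra! hle
      exact absurd (hbmin a ha hle) (not_le.2 hlt)
    have i3 := rho_le_ladderBound (h := h) ha hb hlt le_rfl hbβ
    obtain ⟨-, i4⟩ := ih b hbβ (hbβ.trans hβ) η hηb a haη.le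
    obtain ⟨i5, i6⟩ := ih η hηβ (hηβ.trans hβ) a haη.le ξ hξa
    grind

/-- If `α` is an accumulation point of `D β`, then `rho β α` is `h β`, the least possible value.
Otherwise the ladder has a gap below `α`, so points just below `α` take the same first step as `α`,
and induction applies there. -/
theorem rho_le_of_cofinal {j α β : Ordinal.{u}} (hβ : β < κ.ord) (hαβ : α < β) (h0 : α ≠ 0)
    (hcof : ∀ ζ < α, ∃ ξ, ζ < ξ ∧ ξ < α ∧ rho D h β ξ ≤ j) : rho D h β α ≤ j := by
  induction β using WellFoundedLT.induction with
  | ind β ih =>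
  rcases hD.acc_or_gap hβ hαβ h0 with hacc | ⟨ζ, hζ, hgap⟩
  · obtain ⟨ξ, -, hξ, hle⟩ := hcof 0 (pos_iff_ne_zero.2 h0)
    rw [hD.rho_acc hβ α hacc]
    exact (hD.color_le_rho hβ (hξ.trans hαβ)).trans hle
  · obtain ⟨e, he, heβ, hαe, hmin⟩ := hD.exists_step hβ hαβ
    have hstep : ∀ ξ, ζ < ξ → ξ ≤ α →
        rho D h β ξ = max (ladderBound D h β e) (rho D h e ξ) := fun ξ h1 h2 =>
      rho_eq he heβ (h2.trans hαe) fun e' he' hle => hmin e' he' (hgap e' he' (h1.trans_le hle))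
    have hcof' : ∀ ζ' < α, ∃ ξ, ζ' < ξ ∧ ξ < α ∧ ladderBound D h β e ≤ j ∧ rho D h e ξ ≤ j := by
      intro ζ' hζ'
      obtain ⟨ξ, h1, h2, h3⟩ := hcof _ (max_lt hζ hζ')
      rw [hstep ξ ((le_max_left _ _).trans_lt h1) h2.le] at h3
      exact ⟨ξ, (le_max_right _ _).trans_lt h1, h2, max_le_iff.1 h3⟩
    rw [hstep α hζ le_rfl]
    refine max_le ((hcof' ζ hζ).elim fun _ hx => hx.2.2.1) ?_
    rcases hαe.eq_or_lt with rfl | hlt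
    · rw [rho_self]; exact zero_le
    · refine ih e heβ (heβ.trans hβ) hlt fun ζ' hζ' => ?_
      obtain ⟨ξ, h1, h2, -, h3⟩ := hcof' ζ' hζ'
      exact ⟨ξ, h1, h2, h3⟩

/-- The least ordinal with infinitely many ladder points below it would be an accumulation point of
`D β`, yet under `hP` no ladder point lies below an accumulation point. -/
theorem ladder_finite {β e : Ordinal.{u}} (hβ : β < κ.ord)
    (hP : ¬ ∀ ξ < β, ∃ δ ∈ acc (D β), ξ ≤ δ) (he : e ∈ ladder D β) :
    {x | x ∈ ladder D β ∧ x < e}.Finite := by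
  have hL : ∀ e ∈ ladder D β, ∀ δ ∈ acc (D β), δ ≤ e := fun e he =>
    he.2.elim (fun h => absurd h.1 hP) fun h => h.2
  by_contra hinf
  set S : Set Ordinal.{u} := {α | ¬ {x | x ∈ ladder D β ∧ x < α}.Finite} with hS
  have hm : sInf S ∈ S := csInf_mem ⟨e, hinf⟩
  have hle : sInf S ≤ e := csInf_le' hinf
  set α := sInf S
  have hacc : α ∈ acc (D β) := by
    refine ⟨fun h0 => hm ?_, ?_, fun γ hγ => ?_⟩
    · rw [h0]
      exact Set.finite_empty.subset fun x hx => absurd hx.2 not_lt_zero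
    · rcases hD.unbounded_or_singleton β hβ e he.1 with ⟨e', he', hlt⟩ | hs
      · exact ⟨e', he', hle.trans_lt hlt⟩
      · exact (hm ((Set.finite_singleton e).subset fun x hx => hs ▸ hx.1.1)).elim
    · by_contra! hno
      have hfin : {x | x ∈ ladder D β ∧ x < γ}.Finite := by
        by_contra hγ'
        exact absurd (csInf_le' (s := S) hγ') (not_le.2 hγ)
      refine hm ((hfin.union (Set.finite_singleton γ)).subset fun x hx => ?_)
      rcases lt_trichotomy x γ with h1 | h1 | h1
      · exact .inl ⟨hx.1, h1⟩
      · exact .inr h1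
      · exact absurd hx.2 (not_lt.2 (hno x hx.1.1 h1))
  exact hm (Set.finite_empty.subset fun x hx => absurd (hL x hx.1 α hacc) (not_le.2 hx.2))

/-- When the ladder consists of accumulation points, every pair has value `h β` by `rho_acc`;
otherwise only finitely many pairs are absorbed. -/
theorem ladderBound_lt {lam : Cardinal.{u}} (hlam : lam.IsRegular) {β e : Ordinal.{u}}
    (hh : h β < lam.ord) (hβ : β < κ.ord) (he : e ∈ ladder D β)
    (hlt : ∀ γ < β, ∀ ξ, rho D h γ ξ < lam.ord) : ladderBound D h β e < lam.ord := by
  by_cases hP : ∀ ξ < β, ∃ δ ∈ acc (D β), ξ ≤ δ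
  · have hL : ∀ e ∈ ladder D β, e ∈ acc (D β) := fun e he =>
      he.2.elim (fun h => h.2) fun h => absurd hP h.1
    refine (ladderBound_le le_rfl fun e₁ h₁ e₂ h₂ hlt _ h₂β => ?_).trans_lt hh
    rw [hD.rho_acc (h₂β.trans hβ) e₁ (hD.acc_trans hβ (hL _ h₁) (hL _ h₂) hlt),
      hD.color_eq β hβ e₂ (hL _ h₂)]
  · have hfin := (hD.ladder_finite hβ hP he).insert e
    have : Finite (ladderPairs D β e) := ((hfin.prod hfin).subset fun p hp =>
      ⟨.inr ⟨hp.1, hp.2.2.1.trans_le hp.2.2.2.1⟩, hp.2.2.2.1.eq_or_lt.imp id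
        fun h => ⟨hp.2.1, h⟩⟩).to_subtype
    obtain ⟨δ, hδ, hb⟩ := hlam.exists_bound (ι := ladderPairs D β e)
      (((Cardinal.lift_lt_aleph0.2 Cardinal.mk_lt_aleph0)).trans_le
        (Cardinal.aleph0_le_lift.2 hlam.aleph0_le))
      (fun p => rho D h p.1.2 p.1.1) fun p => hlt _ p.2.2.2.2.2 _
    exact max_lt hh ((Ordinal.iSup_le fun p => (hb p).le).trans_lt hδ)

theorem rho_lt {lam : Cardinal.{u}} (hlam : lam.IsRegular) (hh : ∀ α, h α < lam.ord)
    {β : Ordinal.{u}} (hβ : β < κ.ord) : ∀ ξ, rho D h β ξ < lam.ord := by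
  induction β using WellFoundedLT.induction with
  | ind β ih =>
  intro ξ
  rcases le_or_gt β ξ with hle | hξ
  · rw [rho_of_le hle]; exact hlam.ord_pos
  · obtain ⟨e, he, heβ, hξe, hmin⟩ := hD.exists_step hβ hξ
    rw [rho_eq he heβ hξe hmin]
    exact max_lt (hD.ladderBound_lt hlam (hh β) hβ he fun γ hγ => ih γ hγ (hγ.trans hβ))
      (ih e heβ (heβ.trans hβ) ξ)

end IsColoredCSeq

end Rho

/-! ### Counting the traces of `rho` -/

/-- The function that agrees with `g` below `α` and vanishes from `α` on. -/
noncomputable def trunc (α : Ordinal.{u}) (g : Ordinal.{u} → Ordinal.{u}) :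
    Ordinal.{u} → Ordinal.{u} :=
  fun ξ => if ξ < α then g ξ else 0

theorem trunc_of_lt {α ξ : Ordinal.{u}} (g : Ordinal.{u} → Ordinal.{u}) (hξ : ξ < α) :
    trunc α g ξ = g ξ :=
  if_pos hξ

theorem trunc_eq_iff {α : Ordinal.{u}} {f g : Ordinal.{u} → Ordinal.{u}} :
    trunc α f = trunc α g ↔ ∀ ξ < α, f ξ = g ξ := by
  refine ⟨fun h ξ hξ => ?_, fun h => funext fun ξ => ?_⟩
  · simpa [trunc, hξ] using congrFun h ξ
  · simp only [trunc]
    split_ifs with hξ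
    · exact h ξ hξ
    · rfl

theorem trunc_trunc {α β : Ordinal.{u}} (hle : α ≤ β) (g : Ordinal.{u} → Ordinal.{u}) :
    trunc α (trunc β g) = trunc α g :=
  trunc_eq_iff.2 fun _ hξ => trunc_of_lt g (hξ.trans_le hle)

/-- The restrictions to `α` of the functions `rho D h β` for `α ≤ β < κ`. -/
def rhoTraces (κ : Cardinal.{u}) (D : Ordinal.{u} → Set Ordinal.{u})
    (h : Ordinal.{u} → Ordinal.{u}) (α : Ordinal.{u}) : Set (Ordinal.{u} → Ordinal.{u}) :=
  {g | ∃ β, α ≤ β ∧ β < κ.ord ∧ trunc α (rho D h β) = g}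

/-- The data of one step in the construction of a trace below `α`: the trace below some
`η < α`, the value at `η`, and a lower bound for the values past `η`. -/
abbrev TraceStep (κ lam : Cardinal.{u}) (D : Ordinal.{u} → Set Ordinal.{u})
    (h : Ordinal.{u} → Ordinal.{u}) (α : Ordinal.{u}) :=
  (Σ η : Iio α, rhoTraces κ D h η) × Iio lam.ord × Iio lam.ord

/-- Apply one step to a function. -/
noncomputable def TraceStep.apply {κ lam : Cardinal.{u}} {D : Ordinal.{u} → Set Ordinal.{u}}
    {h : Ordinal.{u} → Ordinal.{u}} {α : Ordinal.{u}} (s : TraceStep κ lam D h α)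
    (g : Ordinal.{u} → Ordinal.{u}) : Ordinal.{u} → Ordinal.{u} :=
  trunc α fun ξ => if ξ < s.1.1 then s.1.2.1 ξ else
    if ξ = s.1.1 then s.2.1 else max s.2.2 (g ξ)

namespace IsColoredCSeq

variable {κ lam : Cardinal.{u}} {D : Ordinal.{u} → Set Ordinal.{u}}
  {h : Ordinal.{u} → Ordinal.{u}} (hD : IsColoredCSeq κ D h)
include hD

/-- Walk from `β` towards `α`. Across a gap `(ζ, α)` of the ladder all points take one common step,
so beyond `ζ` the trace changes only by a maximum with a constant. The walk stops on reaching `α`,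
or at an ordinal whose `D` accumulates at `α`. -/
theorem exists_traceSteps (hlam : lam.IsRegular) (hh : ∀ α, h α < lam.ord) {α β : Ordinal.{u}}
    (hβ : β < κ.ord) (hαβ : α ≤ β) :
    ∃ (L : List (TraceStep κ lam D h α)) (c : Iio lam.ord),
      L.foldr TraceStep.apply (trunc α fun ξ => max c (rho D h α ξ)) = trunc α (rho D h β) := by
  induction β using WellFoundedLT.induction with
  | ind β ih =>
  rcases hαβ.eq_or_lt with rfl | hαβ
  · exact ⟨[], ⟨0, hlam.ord_pos⟩, by simp⟩
  by_cases h0 : α = 0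
  · exact ⟨[], ⟨0, hlam.ord_pos⟩, trunc_eq_iff.2 fun ξ hξ => absurd (h0 ▸ hξ) not_lt_zero⟩
  rcases hD.acc_or_gap hβ hαβ h0 with hacc | ⟨ζ, hζ, hgap⟩
  -- Since `rho β α = h β ≤ rho β ξ`, subadditivity gives `rho β ξ = max (h β) (rho α ξ)`.
  · refine ⟨[], ⟨h β, hh β⟩, trunc_eq_iff.2 fun ξ hξ => ?_⟩
    obtain ⟨h1, h2⟩ := hD.rho_subadditive hβ α hαβ.le ξ hξ.le
    have h3 := hD.color_le_rho hβ (hξ.trans hαβ)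
    rw [hD.rho_acc hβ α hacc] at h1 h2
    grind
  · obtain ⟨e, he, heβ, hαe, hmin⟩ := hD.exists_step hβ hαβ
    obtain ⟨L, c, hL⟩ := ih e heβ (heβ.trans hβ) hαe
    refine ⟨(⟨⟨ζ, hζ⟩, _, β, hζ.le.trans hαβ.le, hβ, rfl⟩, ⟨_, hD.rho_lt hlam hh hβ ζ⟩,
      ⟨_, hD.ladderBound_lt hlam (hh β) hβ he fun γ hγ =>
        hD.rho_lt hlam hh (hγ.trans hβ)⟩) :: L, c, ?_⟩
    rw [List.foldr_cons, hL]
    refine trunc_eq_iff.2 fun ξ hξ => ?_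
    rcases lt_trichotomy ξ ζ with h1 | rfl | h1
    · simp [h1, trunc_of_lt]
    · simp
    · rw [rho_eq he heβ (hξ.le.trans hαe) fun e' he' hle => hmin e' he' (hgap e' he'
        (h1.trans_le hle))]
      simp [h1.not_gt, h1.ne', trunc_of_lt _ hξ]

/-- A trace at `α` is coded by a finite list of steps and an ordinal below `lam`. The steps mention
traces at smaller ordinals only, which are counted by induction. -/
theorem mk_rhoTraces_le (hlam : lam.IsRegular) (hh : ∀ α, h α < lam.ord) (α : Ordinal.{u}) :
    #(rhoTraces κ D h α) ≤ Cardinal.lift.{u + 1} (max α.card lam) := by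
  induction α using WellFoundedLT.induction with
  | ind α ih =>
  set μ := Cardinal.lift.{u + 1} (max α.card lam) with hμ
  have hμ0 : ℵ₀ ≤ μ := Cardinal.aleph0_le_lift.2 (hlam.aleph0_le.trans (le_max_right _ _))
  have hlamμ : #(Iio lam.ord) ≤ μ := by
    rw [Cardinal.mk_Iio_ordinal, card_ord]
    exact Cardinal.lift_le.2 (le_max_right _ _)
  have hsig : #(Σ η : Iio α, rhoTraces κ D h η) ≤ μ := by
    rw [Cardinal.mk_sigma]
    refine (Cardinal.sum_le_sum _ (fun _ => μ) fun η : Iio α => (ih η η.2).trans ?_).trans ?_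
    · exact Cardinal.lift_le.2 (max_le_max_right _ (Ordinal.card_le_card η.2.le))
    · rw [Cardinal.sum_const', Cardinal.mk_Iio_ordinal]
      exact Cardinal.mul_le_of_le hμ0 (Cardinal.lift_le.2 (le_max_left _ _)) le_rfl
  have hstep : #(TraceStep κ lam D h α) ≤ μ := by
    simp only [TraceStep, Cardinal.mk_prod, Cardinal.lift_id]
    exact Cardinal.mul_le_of_le hμ0 hsig (Cardinal.mul_le_of_le hμ0 hlamμ hlamμ)
  have hsub : rhoTraces κ D h α ⊆ range fun p : List (TraceStep κ lam D h α) × Iio lam.ord =>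
      p.1.foldr TraceStep.apply (trunc α fun ξ => max p.2.1 (rho D h α ξ)) := by
    rintro _ ⟨β, hαβ, hβ, rfl⟩
    obtain ⟨L, c, hL⟩ := hD.exists_traceSteps hlam hh hβ hαβ
    exact ⟨(L, c), hL⟩
  refine (Cardinal.mk_le_mk_of_subset hsub).trans (Cardinal.mk_range_le.trans ?_)
  simp only [Cardinal.mk_prod, Cardinal.lift_id]
  exact Cardinal.mul_le_of_le hμ0 ((Cardinal.mk_list_le_max _).trans (max_le hμ0 hstep)) hlamμ

end IsColoredCSeq

/-! ### Trees from height functions -/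

namespace SetTree

section OfHeight

variable {T : Type u} [PartialOrder T] {ht : T → Ordinal.{u}}

/-- A height function under which the predecessors of `t` are the ordinals below the height
of `t`. -/
noncomputable def predIso (hlt : ∀ s t : T, s < t → ht s < ht t)
    (hle : ∀ s s' t : T, s < t → s' < t → ht s ≤ ht s' → s ≤ s')
    (hsurj : ∀ (t : T), ∀ α < ht t, ∃ s < t, ht s = α) (t : T) :
    ((· < ·) : Iio t → Iio t → Prop) ≃r ((· < ·) : (ht t).ToType → (ht t).ToType → Prop) :=
  RelIso.trans (s := ((· < ·) : Iio (ht t) → Iio (ht t) → Prop))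
    ⟨Equiv.ofBijective (fun s => ⟨ht s, hlt s t s.2⟩)
      ⟨fun s s' h => Subtype.ext (le_antisymm
          (hle _ _ t s.2 s'.2 (congrArg Subtype.val h).le)
          (hle _ _ t s'.2 s.2 (congrArg Subtype.val h).ge)),
        fun α => (hsurj t α α.2).elim fun s hs => ⟨⟨s, hs.1⟩, Subtype.ext hs.2⟩⟩, by
      intro s s'
      refine ⟨fun h => ?_, fun h => hlt _ _ h⟩
      refine lt_of_le_of_ne (hle _ _ t s.2 s'.2 (show ht s < ht s' from h).le) fun he => ?_
      subst he
      exact absurd h (lt_irrefl (ht s.1))⟩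
    ToType.mk.toRelIsoLT

/-- A partial order with a suitable height function is a tree. -/
@[reducible]
def ofHeight (hlt : ∀ s t : T, s < t → ht s < ht t)
    (hle : ∀ s s' t : T, s < t → s' < t → ht s ≤ ht s' → s ≤ s')
    (hsurj : ∀ (t : T), ∀ α < ht t, ∃ s < t, ht s = α) : SetTree T where
  wellOrder_pred t := (predIso hlt hle hsurj t).toRelEmbedding.isWellOrder

theorem nodeHeight_ofHeight (hlt : ∀ s t : T, s < t → ht s < ht t)
    (hle : ∀ s s' t : T, s < t → s' < t → ht s ≤ ht s' → s ≤ s')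
    (hsurj : ∀ (t : T), ∀ α < ht t, ∃ s < t, ht s = α) (t : T) :
    @nodeHeight T (ofHeight hlt hle hsurj) t = ht t := by
  let := ofHeight hlt hle hsurj
  exact (predIso hlt hle hsurj t).ordinalType_congr.trans (type_toType _)

end OfHeight

end SetTree

/-! ### The tree of bounded traces -/

/-- The nodes of the tree: the restrictions to some `ht < κ` of the functions
`max bound (rho D h β ·)` with `bound < lam` and `ht ≤ β < κ`. -/
@[ext]
structure AscentNode (κ lam : Cardinal.{u}) (D : Ordinal.{u} → Set Ordinal.{u})
    (h : Ordinal.{u} → Ordinal.{u}) where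
  bound : Ordinal.{u}
  ht : Ordinal.{u}
  fn : Ordinal.{u} → Ordinal.{u}
  bound_lt : bound < lam.ord
  exists_rho : ∃ β, ht ≤ β ∧ β < κ.ord ∧ trunc ht (fun ξ => max bound (rho D h β ξ)) = fn

namespace AscentNode

variable {κ lam : Cardinal.{u}} {D : Ordinal.{u} → Set Ordinal.{u}} {h : Ordinal.{u} → Ordinal.{u}}

instance : Small.{u} (AscentNode κ lam D h) := by
  have : Small.{u} {q : Iio lam.ord × Iio κ.ord × Iio κ.ord | q.2.1 ≤ q.2.2} := small_subtype _ _
  refine small_of_surjective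
    (f := fun q : {q : Iio lam.ord × Iio κ.ord × Iio κ.ord | q.2.1 ≤ q.2.2} =>
      (⟨q.1.1, q.1.2.1, _, q.1.1.2, q.1.2.2, q.2, q.1.2.2.2, rfl⟩ : AscentNode κ lam D h)) ?_
  rintro ⟨j, α, g, hj, β, hαβ, hβ, rfl⟩
  exact ⟨⟨(⟨j, hj⟩, ⟨α, hαβ.trans_lt hβ⟩, ⟨β, hβ⟩), hαβ⟩, rfl⟩

theorem trunc_fn (p : AscentNode κ lam D h) : trunc p.ht p.fn = p.fn := by
  obtain ⟨β, -, -, hg⟩ := p.exists_rho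
  rw [← hg, trunc_trunc le_rfl]

/-- Nodes are ordered by extension of functions. -/
instance : PartialOrder (AscentNode κ lam D h) where
  le p q := p.bound = q.bound ∧ p.ht ≤ q.ht ∧ trunc p.ht q.fn = p.fn
  le_refl p := ⟨rfl, le_rfl, p.trunc_fn⟩
  le_trans p q r hpq hqr := ⟨hpq.1.trans hqr.1, hpq.2.1.trans hqr.2.1, by
    rw [← hpq.2.2, ← hqr.2.2, trunc_trunc hpq.2.1]⟩
  le_antisymm p q hpq hqp := by
    have h2 := le_antisymm hpq.2.1 hqp.2.1
    refine AscentNode.ext hpq.1 h2 ?_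
    rw [← hpq.2.2, h2, trunc_fn]

theorem lt_iff {p q : AscentNode κ lam D h} : p < q ↔ p ≤ q ∧ p.ht < q.ht := by
  refine ⟨fun hlt => ⟨hlt.le, lt_of_le_of_ne hlt.le.2.1 fun he => hlt.ne ?_⟩,
    fun hlt => lt_of_le_of_ne hlt.1 fun he => hlt.2.ne (he ▸ rfl)⟩
  refine AscentNode.ext hlt.le.1 he ?_
  rw [← hlt.le.2.2, he, trunc_fn]

theorem le_of_le {p p' q : AscentNode κ lam D h} (hp : p ≤ q) (hp' : p' ≤ q)
    (hle : p.ht ≤ p'.ht) : p ≤ p' :=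
  ⟨hp.1.trans hp'.1.symm, hle, by rw [← hp'.2.2, trunc_trunc hle, hp.2.2]⟩

theorem exists_lt (q : AscentNode κ lam D h) {α : Ordinal.{u}} (hα : α < q.ht) :
    ∃ p < q, p.ht = α := by
  obtain ⟨β, hβ, hβκ, hg⟩ := q.exists_rho
  refine ⟨⟨q.bound, α, _, q.bound_lt, β, hα.le.trans hβ, hβκ, rfl⟩,
    lt_iff.2 ⟨⟨rfl, hα.le, ?_⟩, hα⟩, rfl⟩
  rw [← hg]
  exact trunc_trunc hα.le _

end AscentNode

/-! ### Absence of cofinal branches -/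

/-- `rho` is unbounded on the pairs from any unbounded subset of `κ`. -/
theorem IsColoredCSeq.rho_unbounded {κ lam : Cardinal.{u}} {D : Ordinal.{u} → Set Ordinal.{u}}
    {h : Ordinal.{u} → Ordinal.{u}} (hD : IsColoredCSeq κ D h) (hκ : κ.IsRegular) (hunc : ℵ₀ < κ)
    (hstat : ∀ j < lam.ord, ∀ E, IsClubSubset E κ.ord → ∃ α ∈ E, j < h α)
    {X : Set Ordinal.{u}} (hXκ : X ⊆ Iio κ.ord) (hX : ∀ δ < κ.ord, ∃ ξ ∈ X, δ < ξ)
    {i : Ordinal.{u}} (hi : i < lam.ord) : ∃ ξ ∈ X, ∃ η ∈ X, ξ < η ∧ i < rho D h η ξ := by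
  by_contra! hbd
  have hclub : IsClubSubset {α | α < κ.ord ∧ α ≠ 0 ∧ ∀ ζ < α, ∃ ξ ∈ X, ζ < ξ ∧ ξ < α} κ.ord := by
    refine (isClubSubset_iff fun γ hγ => hκ.succ_lt_ord hγ).2 ⟨fun α hα => hα.1, fun γ hγ => ?_,
      fun β hβ h0 hcof => ⟨hβ, h0, fun ζ hζ => ?_⟩⟩
    · have hnext : ∀ δ : Ordinal.{u}, ∃ ξ, δ < κ.ord → ξ ∈ X ∧ δ < ξ := fun δ => by
        by_cases hδ : δ < κ.ord
        · obtain ⟨ξ, hξ⟩ := hX δ hδ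
          exact ⟨ξ, fun _ => hξ⟩
        · exact ⟨0, fun h => absurd h hδ⟩
      choose N hN using hnext
      obtain ⟨α, hα, hlt, hclos⟩ :=
        exists_closure_point hκ hunc N (fun ξ hξ => hXκ (hN ξ hξ).1) hγ
      have hακ := ((mem_acc_ord_iff hκ).1 hα).2.1
      exact ⟨α, ⟨hακ, hα.1, fun ζ hζ => ⟨N ζ, (hN ζ (hζ.trans hακ)).1, (hN ζ (hζ.trans hακ)).2,
        hclos ζ hζ⟩⟩, hlt⟩
    · obtain ⟨α, hα, h1, h2⟩ := hcof ζ hζ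
      obtain ⟨ξ, hξ, h3, h4⟩ := hα.2.2 ζ h1
      exact ⟨ξ, hξ, h3, h4.trans h2⟩
  -- A limit `α` of `X` with color above `i`: closure gives `rho x α ≤ i` for some `x ∈ X` past `α`,
  -- and subadditivity then forces `rho α ξ ≤ i < h α`.
  obtain ⟨α, ⟨hακ, h0, hα⟩, hlt⟩ := hstat i hi _ hclub
  obtain ⟨x, hx, hαx⟩ := hX α hακ
  have hxα : rho D h x α ≤ i := hD.rho_le_of_cofinal (hXκ hx) hαx h0 fun ζ hζ => by
    obtain ⟨ξ, hξ, h1, h2⟩ := hα ζ hζ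
    exact ⟨ξ, h1, h2, hbd ξ hξ x hx (h2.trans hαx)⟩
  obtain ⟨ξ, hξ, -, hξα⟩ := hα 0 (pos_iff_ne_zero.2 h0)
  exact absurd ((hD.color_le_rho hακ hξα).trans
    (((hD.rho_subadditive (hXκ hx) α hαx.le ξ hξα.le).2).trans
      (max_le (hbd ξ hξ x hx (hξα.trans hαx)) hxα))) (not_le.2 hlt)

/-- A chain of nodes has bounded height. -/
theorem IsColoredCSeq.not_cofinal_chain {κ lam : Cardinal.{u}} {D : Ordinal.{u} → Set Ordinal.{u}}
    {h : Ordinal.{u} → Ordinal.{u}} (hD : IsColoredCSeq κ D h) (hκ : κ.IsRegular) (hunc : ℵ₀ < κ)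
    (hlam : lam.IsRegular) (hlt : lam < κ) (hh : ∀ α, h α < lam.ord)
    (hstat : ∀ j < lam.ord, ∀ E, IsClubSubset E κ.ord → ∃ α ∈ E, j < h α)
    {B : Set (AscentNode κ lam D h)} (hB : IsChain (· ≤ ·) B) :
    ¬ ∀ α < κ.ord, ∃ t ∈ B, α ≤ t.ht := by
  intro hcof
  have hnode : ∀ ξ : Ordinal.{u}, ∃ x, ξ < κ.ord → ∃ t ∈ B, ξ < t.ht ∧ t.fn ξ = x := fun ξ => by
    by_cases hξ : ξ < κ.ord
    · obtain ⟨t, ht, hle⟩ := hcof _ (hκ.succ_lt_ord hξ)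
      exact ⟨_, fun _ => ⟨t, ht, Order.succ_le_iff.1 hle, rfl⟩⟩
    · exact ⟨0, fun h => absurd h hξ⟩
  choose F hF using hnode
  have hval : ∀ s ∈ B, ∀ t ∈ B, ∀ ξ, ξ < s.ht → ξ < t.ht → s.fn ξ = t.fn ξ := by
    intro s hs t ht ξ h1 h2
    rcases hB.total hs ht with hle | hle
    · rw [← hle.2.2, trunc_of_lt _ h1]
    · rw [← hle.2.2, trunc_of_lt _ h2]
  have hFval : ∀ ξ < κ.ord, ∀ t ∈ B, ξ < t.ht → t.fn ξ = F ξ := fun ξ hξ t ht hlt => by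
    obtain ⟨s, hs, h1, h2⟩ := hF ξ hξ
    rw [← h2, hval t ht s hs ξ hlt h1]
  have hrho : ∀ γ < κ.ord, ∃ β, γ < β ∧ β < κ.ord ∧
      ∀ ξ ≤ γ, rho D h β ξ ≤ F ξ ∧ F ξ < lam.ord := fun γ hγ => by
    obtain ⟨t, ht, hle⟩ := hcof _ (hκ.succ_lt_ord hγ)
    have hj := t.bound_lt
    obtain ⟨β, hβ, hβκ, hg⟩ := t.exists_rho
    have hγt := Order.succ_le_iff.1 hle
    refine ⟨β, hγt.trans_le hβ, hβκ, fun ξ hξ => ?_⟩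
    rw [← hFval ξ (hξ.trans_lt hγ) t ht (hξ.trans_lt hγt), ← hg, trunc_of_lt _ (hξ.trans_lt hγt)]
    exact ⟨le_max_right _ _, max_lt hj (hD.rho_lt hlam hh hβκ ξ)⟩
  -- Pigeonhole: `F` takes fewer than `κ` values, so by regularity some value recurs unboundedly.
  obtain ⟨i, hi, hX⟩ : ∃ i < lam.ord, ∀ δ < κ.ord, ∃ ξ ∈ {ξ | ξ < κ.ord ∧ F ξ = i}, δ < ξ := by
    by_contra! hno
    have hbd : ∀ i : Ordinal.{u}, ∃ δ, i < lam.ord → δ < κ.ord ∧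
        ∀ ξ ∈ {ξ | ξ < κ.ord ∧ F ξ = i}, ξ ≤ δ := fun i => by
      by_cases hi : i < lam.ord
      · obtain ⟨δ, hδ⟩ := hno i hi
        exact ⟨δ, fun _ => hδ⟩
      · exact ⟨0, fun h => absurd h hi⟩
    choose δ hδ using hbd
    obtain ⟨γ, hγ, hmax⟩ := hκ.exists_bound_Iio (ord_lt_ord.2 hlt) δ fun i hi => (hδ i hi).1
    obtain ⟨β, -, -, hβ⟩ := hrho γ hγ
    have hFγ := (hβ γ le_rfl).2
    exact absurd ((hδ _ hFγ).2 γ ⟨hγ, rfl⟩) (not_le.2 (hmax _ hFγ))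
  obtain ⟨ξ, hξ, η, hη, hξη, hgt⟩ := hD.rho_unbounded hκ hunc hstat (fun _ hξ => hξ.1) hX hi
  obtain ⟨β, hηβ, hβ, hle⟩ := hrho η hη.1
  have h1 := (hle ξ hξη.le).1
  have h2 := (hle η le_rfl).1
  rw [hξ.2] at h1
  rw [hη.2] at h2
  exact absurd (((hD.rho_subadditive hβ η hηβ.le ξ hξη.le).2).trans (max_le h1 h2)) (not_le.2 hgt)

/-! ### The Aronszajn tree and its ascent path -/

theorem theorem1p1 (lam κ : Cardinal.{u}) (hlam : lam.IsRegular) (hκ : κ.IsRegular)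
    (hlt : lam < κ) (hsq : Square κ) :
    ∃ (T : Type u) (_ : SetTree T), SetTree.IsAronszajn T κ ∧
      ∃ b : Iio κ.ord → Iio lam.ord → T, SetTree.IsAscentPath b := by
  have hunc : ℵ₀ < κ := hlam.aleph0_le.trans_lt hlt
  obtain ⟨D, h, hD, hh, hstat⟩ := hsq.exists_coloredCSeq hκ hunc hlam hlt
  -- Nodes contain functions on all ordinals, hence live one universe too high; they form a small
  -- type.
  let e : Shrink.{u} (AscentNode κ lam D h) ≃ AscentNode κ lam D h := (equivShrink _).symm
  let : PartialOrder (Shrink.{u} (AscentNode κ lam D h)) := PartialOrder.lift e e.injective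
  have h1 : ∀ s t, s < t → (e s).ht < (e t).ht := fun s t hst =>
    (AscentNode.lt_iff.1 (show e s < e t from hst)).2
  have h2 : ∀ s s' t, s < t → s' < t → (e s).ht ≤ (e s').ht → s ≤ s' :=
    fun s s' t hs hs' hle => AscentNode.le_of_le (show e s < e t from hs).le
      (show e s' < e t from hs').le hle
  have h3 : ∀ t, ∀ α < (e t).ht, ∃ s < t, (e s).ht = α := fun t α hα => by
    obtain ⟨p, hp, hpα⟩ := (e t).exists_lt hα
    exact ⟨e.symm p, show e (e.symm p) < e t by rwa [e.apply_symm_apply],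
      by rwa [e.apply_symm_apply]⟩
  let : SetTree (Shrink.{u} (AscentNode κ lam D h)) := SetTree.ofHeight h1 h2 h3
  have hht : ∀ t, SetTree.nodeHeight t = (e t).ht := SetTree.nodeHeight_ofHeight h1 h2 h3
  let b : Iio κ.ord → Iio lam.ord → Shrink.{u} (AscentNode κ lam D h) := fun α j =>
    e.symm ⟨j, α, trunc α fun ξ => max j (rho D h α ξ), j.2, α, le_rfl, α.2, rfl⟩
  have hb : ∀ α j, e (b α j) =
      ⟨j, α, trunc α fun ξ => max j (rho D h α ξ), j.2, α, le_rfl, α.2, rfl⟩ :=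
    fun α j => by simp only [b, e.apply_symm_apply]
  have hlevel : ∀ (α : Iio κ.ord) j, b α j ∈ SetTree.level _ (α : Ordinal.{u}) := fun α j => by
    change SetTree.nodeHeight _ = _
    rw [hht, hb]
  have hheight : SetTree.height (Shrink.{u} (AscentNode κ lam D h)) = κ.ord := by
    refine le_antisymm (csInf_le' (eq_empty_of_forall_notMem fun t ht => ?_))
      (le_csInf (SetTree.exists_level_eq_empty _) fun α hα => ?_)
    · obtain ⟨β, hβ, hβκ, -⟩ := (e t).exists_rho
      exact absurd ((show _ = κ.ord from ht).symm.le.trans ((hht t).le.trans hβ)) (not_le.2 hβκ)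
    · by_contra! hακ
      exact (hα.subset (hlevel ⟨α, hακ⟩ ⟨0, hlam.ord_pos⟩)).elim
  refine ⟨_, this, ⟨⟨hheight, fun α hα => ?_⟩, ?_⟩, b, hlevel, fun α β hαβ => ?_⟩
  · rw [← Cardinal.lift_lt.{u, u + 1}]
    -- On a fixed level a node is determined by its bound and its function, so the level is counted
    -- by bounds and traces.
    let node : AscentNode κ lam D h → Ordinal.{u} × (Ordinal.{u} → Ordinal.{u}) :=
      fun p => (p.bound, p.fn)
    have hinj : InjOn (fun t => node (e t)) (SetTree.level _ α) := fun s hs t ht hst =>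
      e.injective (AscentNode.ext (congrArg Prod.fst hst)
        (((hht s).symm.trans hs).trans ((hht t).symm.trans ht).symm) (congrArg Prod.snd hst))
    have hsub : (fun t => node (e t)) '' SetTree.level _ α ⊆
        range fun p : Iio lam.ord × rhoTraces κ D h α =>
          (p.1.1, trunc α fun ξ => max p.1.1 (p.2.1 ξ)) := by
      rintro _ ⟨t, ht, rfl⟩
      have htα : (e t).ht = α := (hht t).symm.trans ht
      obtain ⟨β, hβ, hβκ, hg⟩ := (e t).exists_rho
      refine ⟨(⟨_, (e t).bound_lt⟩, ⟨_, β, htα ▸ hβ, hβκ, rfl⟩), Prod.ext rfl ?_⟩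
      simp only [node]
      rw [← hg, htα]
      exact trunc_eq_iff.2 fun ξ hξ => by simp only [trunc_of_lt _ hξ]
    have hle := (Cardinal.mk_le_mk_of_subset hsub).trans Cardinal.mk_range_le
    have heq := Cardinal.mk_image_eq_of_injOn_lift (fun t => node (e t)) (SetTree.level _ α) hinj
    rw [Cardinal.lift_id'.{u, u + 1}] at heq
    rw [← heq]
    refine hle.trans_lt ?_
    simp only [Cardinal.mk_prod, Cardinal.lift_id, Cardinal.mk_Iio_ordinal, card_ord]
    refine Cardinal.mul_lt_of_lt (Cardinal.aleph0_le_lift.2 hκ.aleph0_le)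
      (Cardinal.lift_lt.2 hlt) ((hD.mk_rhoTraces_le hlam hh α).trans_lt ?_)
    exact Cardinal.lift_lt.2 (max_lt (Cardinal.lt_ord.1 hα) hlt)
  · rintro ⟨B, hB, hcof⟩
    refine hD.not_cofinal_chain hκ hunc hlam hlt hh hstat (B := e '' B) ?_ fun α hα => ?_
    · rintro _ ⟨s, hs, rfl⟩ _ ⟨t, ht, rfl⟩ hne
      exact hB hs ht fun heq => hne (congrArg e heq)
    · obtain ⟨t, ht, hle⟩ := hcof α (hheight ▸ hα)
      exact ⟨e t, ⟨t, ht, rfl⟩, hle.trans (hht t).le⟩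
  -- The threshold is `rho β α`: from there on both halves of subadditivity are absorbed by the
  -- maximum with `j`.
  · refine ⟨⟨_, hD.rho_lt hlam hh β.2 α⟩, fun j hj => ?_⟩
    refine show e (b α j) < e (b β j) from AscentNode.lt_iff.2 ⟨?_, ?_⟩
    · rw [hb, hb]
      refine ⟨rfl, hαβ.le, ?_⟩
      dsimp only
      rw [trunc_trunc (show α.1 ≤ β.1 from hαβ.le)]
      refine trunc_eq_iff.2 fun ξ hξ => ?_
      obtain ⟨i1, i2⟩ := hD.rho_subadditive β.2 α.1 hαβ.le ξ hξ.le
      have hj' : rho D h β α ≤ j.1 := hj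
      grind
    · rw [hb, hb]
      exact hαβ
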